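/- Let $D\subset\mathbb R^2=\mathbb C$ be a bounded domain whose closure is homeomorphic to a closed disc and whose boundary $\partial D$ is a rectifiable Jordan curve. (This includes every bounded domain whose closure is diffeomorphic to a closed disc and whose boundary is a closed connected $C^1$ curve, and every polygonal Jordan domain.) Let $G$ be the group of rigid motions $\sigma(z)=az+b$, $|a|=1$, $b\in\mathbb C$. Assume that $D$ has the Pompeiu property: the only $h\in L^1_{loc}(\mathbb R^2)$ with $\int_{\sigma(D)}h\,dx\,dy=0$ for all $\sigma\in G$ is $h=0$. Let $f\in L^1_{loc}(\mathbb R^2)$ be complex-valued and suppose that $$\int_{\partial\sigma(D)}f\,dz=0\quad\text{for every rigid motion }\sigma\in G.$$ Since $f$ is defined only up to null sets, this condition is understood as: for every $a$ with $|a|=1$ and almost every $b\in\mathbb C$ the integral over $\partial\sigma(D)$, $\sigma(z)=az+b$, vanishes (for every $a$ these integrals exist for almost every $b$). Then $f$ is an entire function, that is, $f$ coincides almost everywhere with a function holomorphic on all of $\mathbb C$. -/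

import Mathlib

open MeasureTheory

/-- The rigid motion `z ↦ a z + b` of the plane `ℝ² = ℂ`: the rotation by the unimodular
number `a` followed by the translation by `b`. -/
def rigidMotion (a : Circle) (b z : ℂ) : ℂ := a * z + b

theorem continuous_rigidMotion (a : Circle) (b : ℂ) : Continuous (rigidMotion a b) := by
  unfold rigidMotion
  fun_prop

/-- `D` has the Pompeiu property: a locally integrable function on the plane whose integral over
every rigid image `σ(D)` vanishes is zero (almost everywhere). -/
def HasPompeiuProperty (D : Set ℂ) : Prop :=
  ∀ f : ℂ → ℂ, LocallyIntegrable f volume →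
    (∀ (a : Circle) (b : ℂ), ∫ z in rigidMotion a b '' D, f z = 0) → f =ᵐ[volume] 0

/-- `D` is a bounded plane domain whose closure is homeomorphic to a closed disc. -/
structure IsDiscDomain (D : Set ℂ) : Prop where
  isOpen : IsOpen D
  isConnected : IsConnected D
  isBounded : Bornology.IsBounded D
  closure_homeo : Nonempty (closure D ≃ₜ Metric.closedBall (0 : ℂ) 1)

/-- The closed path `γ` is a Lipschitz parametrization of the boundary of `D` that runs through it
exactly once; so the boundary of `D` is a rectifiable Jordan curve. -/
structure ParametrizesBoundary {p : ℂ} (γ : Path p p) (D : Set ℂ) : Prop where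
  lipschitz : ∃ K, LipschitzWith K γ
  injOn : Set.InjOn γ {t | t ≠ 1}
  range_eq : Set.range γ = frontier D

/-- The line integral `∫ f dz` over the boundary of `σ(D)`, where `σ z = a z + b` and `γ`
parametrizes the boundary of `D`. -/
noncomputable def boundaryIntegral (f : ℂ → ℂ) {p : ℂ} (γ : Path p p) (a : Circle) (b : ℂ) : ℂ :=
  curveIntegral (fun z => f z • ContinuousLinearMap.id ℂ ℂ) (γ.map (continuous_rigidMotion a b))

open Set Filter Topology Complex
open scoped NNReal Real Convolution

/-! For smooth `f` the theorem is Green's formula: the boundary integral over `σ(D)` is a nonzero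
constant times the integral of `∂f/∂z̄` over `σ(D)`, so the Pompeiu property forces `∂f/∂z̄ = 0`.
For general `f`, mollify. By Fubini, `φ * f` satisfies the hypothesis for every translation, so it
is entire for each `C¹` bump `φ` (`differentiable_convolution`). Weyl's lemma
(`exists_entire_of_convolution`) then returns to `f`: the mean value property makes convolution with
a radial `ρ` act on entire functions as multiplication by its mass `m`, and it follows that `f = m⁻¹
(ρ * f)` almost everywhere.

Green's formula on a domain with merely rectifiable boundary (`exists_green`) comes from integrating
the Cauchy–Pompeiu formula along the curve, which gives `π ∫ g dz = ∫ (∂g/∂z̄) · cauchyIndex`. The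
index is constant on `D`, vanishes outside `closure D` because a disc carries a continuous logarithm
of `z - w`, and is irrelevant on the null set `frontier D`. Its value on `D` is never computed. It
is nonzero because otherwise `dz` along the curve would annihilate all test functions, which is
impossible for a simple curve. -/

/-! ### Calculus along Lipschitz curves. -/

theorem exists_lipschitzOnWith_comp {E F : Type*} [NormedAddCommGroup E] [NormedSpace ℝ E]
    [NormedAddCommGroup F] [NormedSpace ℝ F] {G : E → F} {c : ℝ → E} {s : Set ℝ} {K : ℝ≥0}
    (hs : IsCompact s) (hc : LipschitzOnWith K c s) (hG : ∀ t ∈ s, ContDiffAt ℝ 1 G (c t)) :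
    ∃ M, LipschitzOnWith M (fun t => G (c t)) s := by
  apply LocallyLipschitzOn.exists_lipschitzOnWith_of_compact hs
  intro t ht
  obtain ⟨M, u, hu, hM⟩ := (hG t ht).exists_lipschitzOnWith
  refine ⟨M * K, s ∩ c ⁻¹' u, ?_, ?_⟩
  · exact inter_mem self_mem_nhdsWithin ((hc.continuousOn t ht).preimage_mem_nhdsWithin hu)
  · exact hM.comp (hc.mono inter_subset_left) (fun x hx => hx.2)

theorem lipschitzOnWith_integral_of_norm_le {g : ℝ → ℂ} {C : ℝ≥0}
    (hg : IntervalIntegrable g volume 0 1) (hC : ∀ t, ‖g t‖ ≤ C) :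
    LipschitzOnWith C (fun t => ∫ s in (0 : ℝ)..t, g s) (Icc 0 1) := by
  apply LipschitzOnWith.of_dist_le_mul
  intro x hx y hy
  have hi : ∀ z ∈ Icc (0 : ℝ) 1, IntervalIntegrable g volume 0 z := fun z hz =>
    hg.mono_set (by rw [uIcc_of_le hz.1, uIcc_of_le zero_le_one]; exact Icc_subset_Icc_right hz.2)
  rw [dist_eq_norm, intervalIntegral.integral_interval_sub_left (hi x hx) (hi y hy), dist_eq_norm,
    Real.norm_eq_abs]
  exact intervalIntegral.norm_integral_le_of_norm_le_const fun t _ => hC t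

/-- Both `g` and the primitive of `g'` are Lipschitz, hence absolutely continuous. Their difference
has derivative zero almost everywhere, so it is constant. -/
theorem integral_eq_sub_of_lipschitzOnWith {g g' : ℝ → ℂ} {K C : ℝ≥0}
    (hg : LipschitzOnWith K g (Icc 0 1)) (hg' : IntervalIntegrable g' volume 0 1)
    (hC : ∀ t, ‖g' t‖ ≤ C) (hd : ∀ᵐ t, t ∈ Icc (0 : ℝ) 1 → HasDerivAt g (g' t) t)
    {s t : ℝ} (hs : s ∈ Icc (0 : ℝ) 1) (ht : t ∈ Icc (0 : ℝ) 1) :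
    ∫ x in s..t, g' x = g t - g s := by
  have h01 : uIcc (0 : ℝ) 1 = Icc 0 1 := uIcc_of_le zero_le_one
  have hE := lipschitzOnWith_integral_of_norm_le hg' hC
  have hac : AbsolutelyContinuousOnInterval (g - fun t => ∫ s in (0 : ℝ)..t, g' s) 0 1 := by
    rw [← h01] at hE hg
    exact hg.absolutelyContinuousOnInterval.sub hE.absolutelyContinuousOnInterval
  have h0 : ∀ᵐ x, x ∈ uIcc (0 : ℝ) 1 →
      HasDerivAt (g - fun t => ∫ s in (0 : ℝ)..t, g' s) 0 x := by
    filter_upwards [hd, hg'.ae_hasDerivAt_integral] with x hx hx' hxI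
    have := (hx (h01 ▸ hxI)).sub (hx' hxI 0 (by simp))
    rwa [sub_self] at this
  obtain ⟨A, hA⟩ := hac.const_of_ae_hasDerivAt_zero h0
  have h1 := hA t (h01 ▸ ht)
  have h2 := hA s (h01 ▸ hs)
  simp only [Pi.sub_apply] at h1 h2
  have hi : ∀ z ∈ Icc (0 : ℝ) 1, IntervalIntegrable g' volume 0 z := fun z hz =>
    hg'.mono_set (by rw [uIcc_of_le hz.1, uIcc_of_le zero_le_one]; exact Icc_subset_Icc_right hz.2)
  rw [← intervalIntegral.integral_interval_sub_left (hi t ht) (hi s hs)]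
  linear_combination h2 - h1

theorem intervalIntegrable_comp_mul_deriv {c G : ℝ → ℂ} {K : ℝ≥0} (hc : LipschitzWith K c)
    {a b : ℝ} (hG : ContinuousOn G (uIcc a b)) :
    IntervalIntegrable (fun t => G t * deriv c t) volume a b := by
  have h1 : IntervalIntegrable (deriv c) volume a b := by
    refine (intervalIntegrable_const (c := (K : ℝ))).mono_fun
      (stronglyMeasurable_deriv c).aestronglyMeasurable (ae_of_all _ fun t => ?_)
    exact (norm_deriv_le_of_lipschitz hc).trans (le_abs_self _)
  exact h1.continuousOn_mul hG

/-- The fundamental theorem of calculus along a Lipschitz curve. -/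
theorem integral_deriv_comp_mul_deriv_of_lipschitz {c : ℝ → ℂ} {K : ℝ≥0} (hc : LipschitzWith K c)
    {F : ℂ → ℂ} {U : Set ℂ} (hU : IsOpen U) (hF : DifferentiableOn ℂ F U) (hcU : ∀ t, c t ∈ U)
    {s t : ℝ} (hs : s ∈ Icc (0 : ℝ) 1) (ht : t ∈ Icc (0 : ℝ) 1) :
    ∫ x in s..t, deriv F (c x) * deriv c x = F (c t) - F (c s) := by
  have hcont : Continuous fun x => deriv F (c x) :=
    ((hF.deriv hU).continuousOn).comp_continuous hc.continuous hcU
  obtain ⟨B, hB⟩ := isCompact_Icc.exists_bound_of_continuousOn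
    (s := Icc (0 : ℝ) 1) hcont.continuousOn
  obtain ⟨M, hM⟩ := exists_lipschitzOnWith_comp (G := F) isCompact_Icc
    (hc.lipschitzOnWith (s := Icc (0 : ℝ) 1)) fun t _ =>
    ((hF.analyticAt (hU.mem_nhds (hcU t))).contDiffAt (n := 1)).restrict_scalars ℝ
  -- Truncating to `[0, 1]` makes the bound on the derivative hold for all real parameters.
  set g' : ℝ → ℂ := (Icc (0 : ℝ) 1).indicator fun x => deriv F (c x) * deriv c x with hg'
  have hB0 : 0 ≤ B := (norm_nonneg _).trans (hB (0 : ℝ) (by simp))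
  have hg'i : IntervalIntegrable g' volume 0 1 := by
    refine (intervalIntegrable_comp_mul_deriv hc hcont.continuousOn).congr ?_
    intro x hx
    rw [uIoc_of_le zero_le_one] at hx
    exact (indicator_of_mem (Ioc_subset_Icc_self hx) (fun x => deriv F (c x) * deriv c x)).symm
  have key := integral_eq_sub_of_lipschitzOnWith (g' := g') (C := ⟨B, hB0⟩ * K) hM hg'i ?_ ?_ hs ht
  · rw [← key]
    refine intervalIntegral.integral_congr fun x hx => ?_
    exact (indicator_of_mem (uIcc_subset_Icc hs ht hx) (fun x => deriv F (c x) * deriv c x)).symm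
  · intro x
    by_cases hx : x ∈ Icc (0 : ℝ) 1
    · rw [hg', indicator_of_mem hx, norm_mul]
      exact mul_le_mul (hB x hx) (norm_deriv_le_of_lipschitz hc) (norm_nonneg _) hB0
    · rw [hg', indicator_of_notMem hx, norm_zero]
      positivity
  · filter_upwards [hc.ae_differentiableAt_real] with x hx hxI
    rw [hg', indicator_of_mem hxI]
    exact ((hF.differentiableAt (hU.mem_nhds (hcU x))).hasDerivAt).comp x hx.hasDerivAt

theorem integral_deriv_of_lipschitz {c : ℝ → ℂ} {K : ℝ≥0} (hc : LipschitzWith K c)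
    {s t : ℝ} (hs : s ∈ Icc (0 : ℝ) 1) (ht : t ∈ Icc (0 : ℝ) 1) :
    ∫ x in s..t, deriv c x = c t - c s := by
  simpa using integral_deriv_comp_mul_deriv_of_lipschitz hc (F := id) isOpen_univ
    differentiableOn_id (fun _ => mem_univ _) hs ht

/-! ### The index of a closed Lipschitz curve. -/

/-- The integral `∫ dz / (z - w)` along the curve `c` on `[0, 1]`. -/
noncomputable def cauchyIndex (c : ℝ → ℂ) (w : ℂ) : ℂ :=
  ∫ t in (0 : ℝ)..1, (c t - w)⁻¹ * deriv c t

/-- The product of `c t - w` with the exponential of minus the integral is absolutely continuous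
with derivative zero almost everywhere, hence constant. -/
theorem exp_integral_inv_sub {c : ℝ → ℂ} {K : ℝ≥0} (hc : LipschitzWith K c) {w : ℂ} {d : ℝ}
    (hd : 0 < d) (hw : ∀ t, d ≤ ‖c t - w‖) {t : ℝ} (ht : t ∈ Icc (0 : ℝ) 1) :
    exp (∫ s in (0 : ℝ)..t, (c s - w)⁻¹ * deriv c s) * (c 0 - w) = c t - w := by
  set g : ℝ → ℂ := fun s => (c s - w)⁻¹ * deriv c s with hg
  have hne : ∀ t, c t - w ≠ 0 := fun t h => by
    have := hw t
    rw [h, norm_zero] at this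
    linarith
  have hcc := hc.continuous
  have hgi : IntervalIntegrable g volume 0 1 :=
    intervalIntegrable_comp_mul_deriv hc
      ((hcc.sub continuous_const).inv₀ hne).continuousOn
  have hgC : ∀ t, ‖g t‖ ≤ ((⟨d⁻¹, by positivity⟩ * K : ℝ≥0) : ℝ) := fun t => by
    rw [hg, norm_mul, norm_inv]
    exact mul_le_mul (inv_anti₀ hd (hw t)) (norm_deriv_le_of_lipschitz hc) (norm_nonneg _)
      (by positivity)
  have hE := lipschitzOnWith_integral_of_norm_le hgi hgC
  obtain ⟨M, hM⟩ := exists_lipschitzOnWith_comp (G := fun z => exp (-z)) isCompact_Icc hE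
    fun t _ => by fun_prop
  have hcw : LipschitzOnWith K (fun t => c t - w) (uIcc (0 : ℝ) 1) := by
    intro x _ y _
    simpa using hc x y
  rw [← uIcc_of_le (zero_le_one (α := ℝ))] at hM ht
  have hac := hM.absolutelyContinuousOnInterval.smul hcw.absolutelyContinuousOnInterval
  obtain ⟨A, hA⟩ := hac.const_of_ae_hasDerivAt_zero (by
    filter_upwards [hc.ae_differentiableAt_real, hgi.ae_hasDerivAt_integral] with x hx hx' hxI
    have h1 := (hx' hxI 0 (by simp)).neg.cexp.mul (hx.hasDerivAt.sub_const w)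
    have h2 : (-g x) * (c x - w) + deriv c x = 0 := by
      rw [hg]
      field_simp [hne x]
      ring
    convert! h1 using 1
    linear_combination (-exp (-∫ s in (0 : ℝ)..x, g s)) * h2)
  have h1 := hA t ht
  have h0 := hA 0 (by simp)
  simp only [Pi.smul_apply', smul_eq_mul, intervalIntegral.integral_same, neg_zero, exp_zero,
    one_mul] at h0 h1
  rw [h0, ← h1, exp_neg]
  field_simp [exp_ne_zero]

/-- The disc is a retract of the plane, so the map `z - w` on `S` extends to a nonvanishing map on
the simply connected space `ℂ`, which lifts through the covering `exp`. -/
theorem exists_continuous_log {S : Set ℂ} (e : S ≃ₜ Metric.closedBall (0 : ℂ) 1) {w : ℂ}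
    (hw : w ∉ S) : ∃ l : S → ℂ, Continuous l ∧ ∀ z, exp (l z) = z - w := by
  -- The radial retraction of the plane onto the closed unit disc.
  have hr : ∀ x : ℂ, ((max 1 ‖x‖)⁻¹ : ℝ) • x ∈ Metric.closedBall (0 : ℂ) 1 := fun x => by
    have h1 : 0 < max 1 ‖x‖ := by positivity
    rw [mem_closedBall_zero_iff, norm_smul, norm_inv, Real.norm_of_nonneg h1.le,
      inv_mul_le_one₀ h1]
    exact le_max_right _ _
  have hrc : Continuous fun x : ℂ => ((max 1 ‖x‖)⁻¹ : ℝ) • x := by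
    refine Continuous.smul (Continuous.inv₀ (continuous_const.max continuous_norm)
      fun x => ?_) continuous_id
    positivity
  let f : C(ℂ, ℂ) := ⟨fun x => (e.symm ⟨_, hr x⟩ : ℂ) - w,
    (continuous_subtype_val.comp (e.symm.continuous.comp (hrc.subtype_mk hr))).sub
      continuous_const⟩
  have hf : ∀ x, f x ∈ ({0}ᶜ : Set ℂ) := fun x h =>
    hw (by rw [← sub_eq_zero.1 h]; exact (e.symm ⟨_, hr x⟩).2)
  obtain ⟨L, ⟨-, hL⟩, -⟩ := isCoveringMapOn_exp.existsUnique_continuousMap_lifts f (a₀ := 0)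
    (e₀ := log (f 0)) (exp_log (hf 0)) hf
  refine ⟨fun z => L (e z), by fun_prop, fun z => ?_⟩
  have h1 := congrFun hL (e z)
  simp only [Function.comp_apply] at h1
  rw [h1]
  have h2 : ((max 1 ‖(e z : ℂ)‖)⁻¹ : ℝ) • (e z : ℂ) = e z := by
    have := mem_closedBall_zero_iff.1 (e z).2
    rw [max_eq_left this, inv_one, one_smul]
  have h3 : (⟨_, hr (e z)⟩ : Metric.closedBall (0 : ℂ) 1) = e z := Subtype.ext h2
  simp only [f, ContinuousMap.coe_mk, h3, e.symm_apply_apply]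

theorem eq_of_exp_eq_on_Icc {u v : ℝ → ℂ} (hu : ContinuousOn u (Icc 0 1))
    (hv : ContinuousOn v (Icc 0 1)) (h0 : u 0 = v 0)
    (h : ∀ t ∈ Icc (0 : ℝ) 1, exp (u t) = exp (v t)) : u 1 = v 1 := by
  have := Complex.isCoveringMap_exp.eqOn_of_comp_eqOn (s := Icc (0 : ℝ) 1) isPreconnected_Icc
    hu hv (fun t ht => Subtype.ext (h t ht)) (left_mem_Icc.2 zero_le_one) h0
  exact this (right_mem_Icc.2 zero_le_one)

theorem exists_pos_le_norm_sub {c : ℝ → ℂ} {S : Set ℂ} (hS : IsClosed S) (hcS : ∀ t, c t ∈ S)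
    {w : ℂ} (hw : w ∉ S) : ∃ d > 0, ∀ t, d ≤ ‖c t - w‖ := by
  obtain ⟨d, hd, h⟩ := Metric.isOpen_iff.1 hS.isOpen_compl w hw
  refine ⟨d, hd, fun t => ?_⟩
  by_contra! hlt
  exact h (mem_ball_iff_norm.2 hlt) (hcS t)

/-- A closed curve in a topological disc has index zero about every point outside of it. -/
theorem cauchyIndex_eq_zero {c : ℝ → ℂ} {K : ℝ≥0} (hc : LipschitzWith K c) (h01 : c 0 = c 1)
    {S : Set ℂ} (hS : IsClosed S) (e : S ≃ₜ Metric.closedBall (0 : ℂ) 1) (hcS : ∀ t, c t ∈ S)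
    {w : ℂ} (hw : w ∉ S) : cauchyIndex c w = 0 := by
  obtain ⟨l, hl, hlw⟩ := exists_continuous_log e hw
  obtain ⟨d, hd, hdw⟩ := exists_pos_le_norm_sub hS hcS hw
  have hne : ∀ t, c t - w ≠ 0 := fun t h => by
    have := hdw t
    rw [h, norm_zero] at this
    linarith
  have hgi : IntervalIntegrable (fun s => (c s - w)⁻¹ * deriv c s) volume 0 1 :=
    intervalIntegrable_comp_mul_deriv hc
      ((hc.continuous.sub continuous_const).inv₀ hne).continuousOn
  have hE : ContinuousOn (fun t => ∫ s in (0 : ℝ)..t, (c s - w)⁻¹ * deriv c s) (Icc 0 1) := by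
    have := intervalIntegral.continuousOn_primitive_interval
      (a := (0 : ℝ)) (b := 1) (f := fun s => (c s - w)⁻¹ * deriv c s) (μ := volume)
    rw [uIcc_of_le zero_le_one] at this
    refine this ?_
    rwa [← intervalIntegrable_iff_integrableOn_Icc_of_le zero_le_one]
  -- Both functions are logarithms of `(c t - w) / (c 0 - w)` starting at `0`; the one built from
  -- `l` returns to `0` because the curve is closed.
  have key := eq_of_exp_eq_on_Icc (v := fun t => l ⟨c t, hcS t⟩ - l ⟨c 0, hcS 0⟩) hE
    (by have := hc.continuous; fun_prop) (by simp) fun t ht => by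
      have := exp_integral_inv_sub hc hd hdw ht
      rw [exp_sub, hlw, hlw, eq_div_iff (hne 0)]
      exact this
  have h2 : l ⟨c 1, hcS 1⟩ = l ⟨c 0, hcS 0⟩ := by simp_rw [h01]
  rw [h2, sub_self] at key
  exact key

/-- Differentiating under the integral gives the integrand `(z - w)⁻²`, which has the single-valued
primitive `-(z - w)⁻¹`, so its integral over a closed curve vanishes. -/
theorem hasDerivAt_cauchyIndex {c : ℝ → ℂ} {K : ℝ≥0} (hc : LipschitzWith K c) (h01 : c 0 = c 1)
    {S : Set ℂ} (hS : IsClosed S) (hcS : ∀ t, c t ∈ S) {w : ℂ} (hw : w ∉ S) :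
    HasDerivAt (cauchyIndex c) 0 w := by
  obtain ⟨d, hd, hdw⟩ := exists_pos_le_norm_sub hS hcS hw
  have hne : ∀ x ∈ Metric.ball w (d / 2), ∀ t, d / 2 ≤ ‖c t - x‖ := fun x hx t => by
    have h1 := mem_ball_iff_norm.1 hx
    have h2 : ‖c t - w‖ ≤ ‖c t - x‖ + ‖x - w‖ := by
      simpa using norm_add_le (c t - x) (x - w)
    linarith [hdw t]
  have hne' : ∀ x ∈ Metric.ball w (d / 2), ∀ t, c t - x ≠ 0 := fun x hx t h => by
    have := hne x hx t
    rw [h, norm_zero] at this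
    linarith
  have hww : w ∈ Metric.ball w (d / 2) := Metric.mem_ball_self (by positivity)
  have hint : ∀ x ∈ Metric.ball w (d / 2),
      IntervalIntegrable (fun t => (c t - x)⁻¹ * deriv c t) volume 0 1 := fun x hx =>
    intervalIntegrable_comp_mul_deriv hc
      ((hc.continuous.sub continuous_const).inv₀ (hne' x hx)).continuousOn
  have hcont2 : Continuous fun t => ((c t - w) ^ 2)⁻¹ :=
    ((hc.continuous.sub continuous_const).pow 2).inv₀ fun t => pow_ne_zero 2 (hne' w hww t)
  have key := (intervalIntegral.hasDerivAt_integral_of_dominated_loc_of_deriv_le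
    (μ := volume) (a := (0 : ℝ)) (b := 1) (𝕜 := ℂ) (x₀ := w)
    (F := fun x t => (c t - x)⁻¹ * deriv c t)
    (F' := fun x t => ((c t - x) ^ 2)⁻¹ * deriv c t)
    (s := Metric.ball w (d / 2)) (bound := fun _ => ((d / 2) ^ 2)⁻¹ * K)
    (Metric.ball_mem_nhds _ (by positivity)) ?_ (hint w hww) ?_ ?_ intervalIntegrable_const ?_).2
  · have h2 : ∫ t in (0 : ℝ)..1, ((c t - w) ^ 2)⁻¹ * deriv c t = 0 := by
      have := integral_deriv_comp_mul_deriv_of_lipschitz hc (F := fun z => -(z - w)⁻¹)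
        (U := {w}ᶜ) isOpen_compl_singleton ?_ (fun t => sub_ne_zero.1 (hne' w hww t))
        (left_mem_Icc.2 zero_le_one) (right_mem_Icc.2 zero_le_one)
      · rw [h01, sub_self] at this
        rw [← this]
        refine intervalIntegral.integral_congr fun t _ => ?_
        have hd : HasDerivAt (fun z => -(z - w)⁻¹) (((c t - w) ^ 2)⁻¹) (c t) := by
          convert! (((hasDerivAt_id (c t)).sub_const w).inv (hne' w hww t)).neg using 1
          simp [neg_div]
        simp only [hd.deriv]
      · intro z hz
        have : z - w ≠ 0 := sub_ne_zero.2 hz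
        exact (((differentiableAt_id.sub_const w).inv this).neg).differentiableWithinAt
    rwa [h2] at key
  · filter_upwards [Metric.ball_mem_nhds w (half_pos hd)] with x hx
    exact (hint x hx).def'.aestronglyMeasurable
  · exact (intervalIntegrable_comp_mul_deriv hc hcont2.continuousOn).def'.aestronglyMeasurable
  · refine ae_of_all _ fun t _ x hx => ?_
    rw [norm_mul, norm_inv, norm_pow]
    refine mul_le_mul (inv_anti₀ (by positivity) ?_) (norm_deriv_le_of_lipschitz hc)
      (norm_nonneg _) (by positivity)
    exact pow_le_pow_left₀ (by positivity) (hne x hx t) 2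
  · refine ae_of_all _ fun t _ x hx => ?_
    refine HasDerivAt.mul_const ?_ _
    convert! ((hasDerivAt_id x).const_sub (c t)).inv (hne' x hx t) using 1
    simp

theorem exists_cauchyIndex_eq {c : ℝ → ℂ} {K : ℝ≥0} (hc : LipschitzWith K c) (h01 : c 0 = c 1)
    {S : Set ℂ} (hS : IsClosed S) (hcS : ∀ t, c t ∈ S) {D : Set ℂ} (hD : IsOpen D)
    (hDc : IsPreconnected D) (hDS : Disjoint D S) : ∃ k, ∀ w ∈ D, cauchyIndex c w = k := by
  have h : ∀ w ∈ D, HasDerivAt (cauchyIndex c) 0 w := fun w hw =>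
    hasDerivAt_cauchyIndex hc h01 hS hcS (disjoint_left.1 hDS hw)
  exact hD.exists_is_const_of_deriv_eq_zero hDc
    (fun w hw => (h w hw).differentiableAt.differentiableWithinAt) fun w hw => (h w hw).deriv

/-- A Lipschitz image of the line has Hausdorff dimension at most one. -/
theorem volume_range_eq_zero {c : ℝ → ℂ} {K : ℝ≥0} (hc : LipschitzWith K c) :
    volume (range c) = 0 := by
  set g : ℝ → ℝ × ℝ := fun t => measurableEquivRealProd (c t) with hg
  have hgL : LipschitzWith K g := by
    refine LipschitzWith.of_dist_le_mul fun x y => ?_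
    refine le_trans ?_ (hc.dist_le_mul x y)
    rw [Prod.dist_eq, dist_eq_norm (c x)]
    exact max_le (abs_re_le_norm (c x - c y)) (abs_im_le_norm (c x - c y))
  have h1 : volume (range g) = 0 := by
    rw [← hausdorffMeasure_prod_real]
    refine hausdorffMeasure_of_dimH_lt (d := 2) (hgL.dimH_range_le.trans_lt ?_)
    rw [Real.dimH_univ]
    norm_num
  have h2 : range c = measurableEquivRealProd ⁻¹' range g := by
    ext z
    simp [hg, Complex.ext_iff]
  rw [h2, volume_preserving_equiv_real_prod.measure_preimage_equiv, h1]

/-! ### The operator `dbar` and the Cauchy–Pompeiu formula. -/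

/-- The Wirtinger derivative `∂g/∂z̄`. -/
noncomputable def dbar (g : ℂ → ℂ) (z : ℂ) : ℂ :=
  (fderiv ℝ g z 1 + I * fderiv ℝ g z I) / 2

theorem continuous_dbar {g : ℂ → ℂ} (hg : ContDiff ℝ 1 g) : Continuous (dbar g) := by
  have h := hg.continuous_fderiv one_ne_zero
  unfold dbar
  fun_prop

theorem hasCompactSupport_dbar {g : ℂ → ℂ} (hg : HasCompactSupport g) :
    HasCompactSupport (dbar g) := by
  have h := hg.fderiv ℝ
  exact h.comp_left (g := fun L : ℂ →L[ℝ] ℂ => (L 1 + I * L I) / 2) (by simp)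

theorem differentiable_of_dbar_eq_zero {g : ℂ → ℂ} (hg : Differentiable ℝ g)
    (h : ∀ z, dbar g z = 0) : Differentiable ℂ g := by
  intro z
  rw [differentiableAt_complex_iff_differentiableAt_real]
  refine ⟨hg z, ?_⟩
  have h1 := h z
  unfold dbar at h1
  rw [smul_eq_mul]
  linear_combination (-2 * I) * h1 + fderiv ℝ g z I * I_sq

/-- The polar form of `dbar`. -/
theorem dbar_eq_polar (g : ℂ → ℂ) (z : ℂ) (θ : ℝ) :
    dbar g z = exp (θ * I) *
      ((fderiv ℝ g z (exp (θ * I)) + I * fderiv ℝ g z (I * exp (θ * I))) / 2) := by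
  have h1 : exp (θ * I) = (Real.cos θ) • (1 : ℂ) + (Real.sin θ) • I := by
    rw [exp_mul_I]
    simp
  have h2 : I * exp (θ * I) = (-Real.sin θ) • (1 : ℂ) + (Real.cos θ) • I := by
    rw [h1]
    simp only [real_smul]
    push_cast
    linear_combination sin (θ : ℂ) * I_sq
  rw [h2, h1]
  simp only [map_add, map_smul]
  simp only [real_smul, dbar]
  have h3 : (Real.cos θ : ℂ) ^ 2 + (Real.sin θ : ℂ) ^ 2 = 1 := by
    exact_mod_cast Real.cos_sq_add_sin_sq θ
  push_cast at h3 ⊢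
  linear_combination (-(fderiv ℝ g z 1 + I * fderiv ℝ g z I) / 2) * h3 +
    ((-cos (θ : ℂ) * sin (θ : ℂ) * fderiv ℝ g z I + sin (θ : ℂ) ^ 2 * fderiv ℝ g z 1) / 2) * I_sq

theorem polarCoord_symm_eq (p : ℝ × ℝ) : Complex.polarCoord.symm p = p.1 * exp (p.2 * I) := by
  rw [Complex.polarCoord_symm_apply, exp_mul_I]
  push_cast
  rfl

/-- The Cauchy–Pompeiu formula for compactly supported functions. -/
theorem integral_dbar_div {g : ℂ → ℂ} (hg : ContDiff ℝ 1 g) (hgc : HasCompactSupport g) (z : ℂ) :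
    ∫ w, dbar g (z + w) / w = -π * g z := by
  obtain ⟨R, hR0, hR⟩ : ∃ R > 0, ∀ w, R ≤ ‖w‖ → fderiv ℝ g (z + w) = 0 ∧ g (z + w) = 0 := by
    obtain ⟨R, hR⟩ := hgc.isCompact.isBounded.subset_ball z
    refine ⟨max R 1, by positivity, fun w hw => ?_⟩
    have : z + w ∉ tsupport g := fun h => by
      have := mem_ball_iff_norm.1 (hR h)
      rw [add_sub_cancel_left] at this
      exact absurd ((le_max_left R 1).trans hw) (not_le.2 this)
    exact ⟨image_eq_zero_of_notMem_tsupport fun h => this (tsupport_fderiv_subset ℝ h),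
      image_eq_zero_of_notMem_tsupport this⟩
  set A : ℝ × ℝ → ℂ := fun p => fderiv ℝ g (z + p.1 * exp (p.2 * I)) (exp (p.2 * I)) with hA
  set B : ℝ × ℝ → ℂ := fun p => fderiv ℝ g (z + p.1 * exp (p.2 * I)) (I * exp (p.2 * I)) with hB
  have hD := hg.continuous_fderiv one_ne_zero
  have hAc : Continuous A := by fun_prop
  have hBc : Continuous B := by fun_prop
  set S : Set (ℝ × ℝ) := Ioc 0 R ×ˢ Ioo (-π) π with hS
  have hint : ∀ f : ℝ × ℝ → ℂ, Continuous f → IntegrableOn f S := fun f hf =>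
    (hf.continuousOn.integrableOn_compact (isCompact_Icc.prod isCompact_Icc)).mono_set
      (prod_mono Ioc_subset_Icc_self Ioo_subset_Icc_self)
  have hu : ∀ θ : ℝ, ‖exp (θ * I)‖ = 1 := norm_exp_ofReal_mul_I
  -- The Jacobian `r` and the phase from `dbar_eq_polar` cancel the singular factor `1 / w`.
  have h1 : ∫ w, dbar g (z + w) / w = ∫ p in S, (A p + I * B p) / 2 := by
    rw [← Complex.integral_comp_polarCoord_symm]
    have h2 : ∀ p ∈ polarCoord.target, p.1 • (dbar g (z + Complex.polarCoord.symm p) /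
        Complex.polarCoord.symm p) = (A p + I * B p) / 2 := by
      rintro ⟨r, θ⟩ ⟨hr, hθ⟩
      have hr' : (r : ℂ) ≠ 0 := ofReal_ne_zero.2 (ne_of_gt hr)
      rw [polarCoord_symm_eq, dbar_eq_polar g _ θ, real_smul]
      simp only [hA, hB]
      field_simp [exp_ne_zero]
    rw [setIntegral_congr_fun polarCoord.open_target.measurableSet h2]
    refine setIntegral_eq_of_subset_of_forall_sdiff_eq_zero
      (f := fun p => (A p + I * B p) / 2) polarCoord.open_target.measurableSet ?_ ?_
    · exact prod_mono Ioc_subset_Ioi_self subset_rfl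
    · rintro ⟨r, θ⟩ ⟨⟨hr, hθ⟩, hn⟩
      have hrR : R < r := by
        by_contra! h
        exact hn ⟨⟨hr, h⟩, hθ⟩
      have : R ≤ ‖(r : ℂ) * exp (θ * I)‖ := by
        rw [norm_mul, hu, mul_one, norm_real]
        exact hrR.le.trans (le_abs_self r)
      simp [hA, hB, (hR _ this).1]
  have hdg : ∀ x, HasFDerivAt g (fderiv ℝ g x) x := fun x =>
    (hg.differentiable one_ne_zero x).hasFDerivAt
  -- `A` is the radial derivative of `g` about `z`, and `g` vanishes at radius `R`.
  have hIA : ∫ p in S, A p = -(2 * π) * g z := by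
    have hsw : ∫ p in S, A p = ∫ θ in Ioo (-π) π, ∫ r in Ioc 0 R, A (r, θ) := by
      rw [hS, Measure.volume_eq_prod, ← Measure.prod_restrict, integral_prod_symm]
      rw [Measure.prod_restrict]
      exact hint A hAc
    have hin : ∀ θ : ℝ, ∫ r in Ioc 0 R, A (r, θ) = - g z := fun θ => by
      rw [← intervalIntegral.integral_of_le hR0.le,
        intervalIntegral.integral_eq_sub_of_hasDerivAt
          (f := fun r : ℝ => g (z + r * exp (θ * I)))]
      · have : R ≤ ‖(R : ℂ) * exp (θ * I)‖ := by
          rw [norm_mul, hu, mul_one, norm_real]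
          exact le_abs_self R
        simp [(hR _ this).2]
      · intro r _
        have h3 : HasDerivAt (fun r : ℝ => z + r * exp (θ * I)) (exp (θ * I)) r := by
          simpa using ((hasDerivAt_id r).ofReal_comp.mul_const (exp (θ * I))).const_add z
        exact (hdg _).comp_hasDerivAt r h3
      · exact (hAc.comp (by fun_prop : Continuous fun r : ℝ => (r, θ))).intervalIntegrable _ _
    rw [hsw]
    simp only [hin]
    rw [setIntegral_const, real_smul, Measure.real, Real.volume_Ioo, ENNReal.toReal_ofReal
      (by linarith [Real.pi_pos])]
    push_cast
    ring
  have hIB : ∫ p in S, B p = 0 := by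
    have hsw : ∫ p in S, B p = ∫ r in Ioc 0 R, ∫ θ in Ioo (-π) π, B (r, θ) :=
      setIntegral_prod _ (hint B hBc)
    rw [hsw]
    refine setIntegral_eq_zero_of_forall_eq_zero fun r hr => ?_
    have hr' : (r : ℂ) ≠ 0 := ofReal_ne_zero.2 (ne_of_gt hr.1)
    -- The factor `r` turns `B` into the `θ`-derivative of a periodic function.
    have h3 : ∫ θ in (-π)..π, r * B (r, θ) = 0 := by
      rw [intervalIntegral.integral_eq_sub_of_hasDerivAt
          (f := fun θ : ℝ => g (z + r * exp (θ * I)))]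
      · have : exp (((-π : ℝ) : ℂ) * I) = exp ((π : ℝ) * I) := by
          rw [exp_pi_mul_I, ofReal_neg, neg_mul, exp_neg, exp_pi_mul_I]
          norm_num
        rw [this, sub_self]
      · intro θ _
        have h3 : HasDerivAt (fun θ : ℝ => z + r * exp (θ * I)) (r • (I * exp (θ * I))) θ := by
          convert! ((((hasDerivAt_id θ).ofReal_comp.mul_const I).cexp).const_mul (r : ℂ)).const_add z
            using 1
          simp
          exact Or.inl (mul_comm _ _)
        have h4 := (hdg _).comp_hasDerivAt θ h3
        rw [map_smul, real_smul] at h4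
        exact h4
      · exact (continuous_const.mul
          (hBc.comp (by fun_prop : Continuous fun θ : ℝ => (r, θ)))).intervalIntegrable _ _
    rw [intervalIntegral.integral_const_mul, mul_eq_zero] at h3
    rw [← integral_Ioc_eq_integral_Ioo, ← intervalIntegral.integral_of_le
      (by linarith [Real.pi_pos])]
    exact h3.resolve_left hr'
  rw [h1, integral_div, integral_add (hint A hAc) ((hint B hBc).const_mul I), hIA,
    integral_const_mul, hIB]
  ring

/-! ### Green's formula on a disc domain. -/

theorem integrable_indicator_inv_norm (R : ℝ) :
    Integrable fun w : ℂ => (Iio R).indicator (fun r : ℝ => r⁻¹) ‖w‖ := by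
  rw [integrable_fun_norm_addHaar volume (f := (Iio R).indicator fun r : ℝ => r⁻¹)]
  have h : IntegrableOn ((Iio R).indicator fun _ : ℝ => (1 : ℝ)) (Ioi 0) := by
    rw [IntegrableOn, integrable_indicator_iff measurableSet_Iio, IntegrableOn,
      Measure.restrict_restrict measurableSet_Iio, Iio_inter_Ioi]
    exact integrableOn_const (measure_Ioo_lt_top.ne)
  refine h.congr_fun (fun r hr => ?_) measurableSet_Ioi
  have hr' : r ≠ 0 := ne_of_gt hr
  by_cases hrR : r ∈ Iio R
  · simp [hrR, hr']
  · simp [hrR]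

/-- The singularity `1 / |w|` is integrable near a point of the plane, and by translation invariance
its integral does not depend on the point of the curve. -/
theorem integrable_dbar_mul_inv {c : ℝ → ℂ} {K : ℝ≥0} (hc : LipschitzWith K c)
    (hcb : Bornology.IsBounded (range c)) {g : ℂ → ℂ} (hg : ContDiff ℝ 1 g)
    (hgc : HasCompactSupport g) :
    Integrable (fun p : ℝ × ℂ => dbar g p.2 * ((c p.1 - p.2)⁻¹ * deriv c p.1))
      ((volume.restrict (Ioc 0 1)).prod volume) := by
  obtain ⟨M, hM⟩ := (hasCompactSupport_dbar hgc).exists_bound_of_continuous (continuous_dbar hg)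
  obtain ⟨R, hR⟩ := hcb.subset_ball 0
  obtain ⟨T, hT⟩ := (hasCompactSupport_dbar hgc).isCompact.isBounded.subset_ball 0
  -- Cutting off at `R + T` loses nothing: the curve lies in the ball of radius `R`, the support of
  -- `dbar g` in that of radius `T`.
  set k : ℂ → ℝ := fun w => (Iio (R + T)).indicator (fun r : ℝ => r⁻¹) ‖w‖ with hk
  have hki : Integrable k := integrable_indicator_inv_norm _
  have hkn : ∀ w, 0 ≤ k w := fun w => by
    by_cases h : ‖w‖ ∈ Iio (R + T)
    · simp [hk, h]
    · simp [hk, h]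
  have hM0 : 0 ≤ M := (norm_nonneg _).trans (hM 0)
  have hcc := hc.continuous
  have hkm : Measurable k :=
    (measurable_inv.indicator measurableSet_Iio).comp measurable_norm
  have hP : Integrable (fun p : ℝ × ℂ => M * K * k (p.2 - c p.1))
      ((volume.restrict (Ioc 0 1)).prod volume) := by
    refine Integrable.const_mul ?_ _
    rw [integrable_prod_iff]
    · refine ⟨ae_of_all _ fun t => hki.comp_sub_right (c t), ?_⟩
      simp only [integral_sub_right_eq_self (fun w => ‖k w‖)]
      exact integrable_const _
    · exact (hkm.comp (by fun_prop)).aestronglyMeasurable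
  refine hP.mono' ?_ (ae_of_all _ ?_)
  · refine Measurable.aestronglyMeasurable ?_
    have h1 := (continuous_dbar hg).measurable
    have h2 := measurable_deriv c
    fun_prop
  · rintro ⟨t, w⟩
    simp only [norm_mul, norm_inv]
    by_cases hw : dbar g w = 0
    · rw [hw, norm_zero, zero_mul]
      exact mul_nonneg (mul_nonneg hM0 K.2) (hkn _)
    · have h1 := mem_ball_zero_iff.1 (hT (subset_tsupport _ hw))
      have h2 := mem_ball_zero_iff.1 (hR (mem_range_self t))
      have h3 : ‖w - c t‖ < R + T := (norm_sub_le _ _).trans_lt (by linarith)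
      have h4 : k (w - c t) = ‖c t - w‖⁻¹ := by
        rw [hk, norm_sub_rev (c t)]
        exact indicator_of_mem (mem_Iio.2 h3) _
      rw [h4]
      have h5 : ‖deriv c t‖ ≤ K := norm_deriv_le_of_lipschitz hc
      calc ‖dbar g w‖ * (‖c t - w‖⁻¹ * ‖deriv c t‖) ≤ M * (‖c t - w‖⁻¹ * K) := by
            gcongr
            exact hM w
        _ = M * K * ‖c t - w‖⁻¹ := by ring

/-- Apply the Cauchy–Pompeiu formula at each point of the curve and exchange the two integrals. -/
theorem pi_mul_integral_comp_mul_deriv {c : ℝ → ℂ} {K : ℝ≥0} (hc : LipschitzWith K c)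
    (hcb : Bornology.IsBounded (range c)) {g : ℂ → ℂ} (hg : ContDiff ℝ 1 g)
    (hgc : HasCompactSupport g) :
    π * ∫ t in (0 : ℝ)..1, g (c t) * deriv c t = ∫ w, dbar g w * cauchyIndex c w := by
  have h1 : ∀ t, ∫ w, dbar g w * ((c t - w)⁻¹ * deriv c t) = π * (g (c t) * deriv c t) := fun t => by
    have h2 : ∫ w, dbar g w / (w - c t) = -π * g (c t) := by
      rw [← integral_dbar_div hg hgc, ← integral_add_left_eq_self _ (c t)]
      simp only [add_sub_cancel_left]
    have h3 : ∀ w, dbar g w * ((c t - w)⁻¹ * deriv c t) =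
        -deriv c t * (dbar g w / (w - c t)) := fun w => by
      rw [← neg_sub w, inv_neg]
      ring
    simp only [h3]
    rw [integral_const_mul, h2]
    ring
  rw [← intervalIntegral.integral_const_mul, intervalIntegral.integral_of_le zero_le_one]
  simp only [← h1]
  rw [integral_integral_swap (integrable_dbar_mul_inv hc hcb hg hgc)]
  refine integral_congr_ae (ae_of_all _ fun w => ?_)
  simp only [cauchyIndex]
  rw [integral_const_mul, intervalIntegral.integral_of_le zero_le_one]

theorem exists_contDiff_bump {C U : Set ℂ} (hC : IsCompact C) (hU : IsOpen U) (hCU : C ⊆ U) :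
    ∃ g : ℂ → ℝ, ContDiff ℝ 1 g ∧ HasCompactSupport g ∧ tsupport g ⊆ U ∧
      (∀ x, g x ∈ Icc (0 : ℝ) 1) ∧ ∀ x ∈ C, g x = 1 := by
  obtain ⟨L, hL, hCL, hLU⟩ := exists_compact_between hC hU hCU
  obtain ⟨g, hg1, hg0, hg⟩ := exists_contMDiffMap_one_nhds_of_subset_interior
    (modelWithCornersSelf ℝ ℂ) (n := 1) hC.isClosed hCL
  have hs : tsupport g ⊆ L :=
    closure_minimal (fun x hx => by_contra fun h => hx (hg0 x h)) hL.isClosed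
  exact ⟨g, g.contMDiff.contDiff, hL.of_isClosed_subset (isClosed_tsupport g) hs,
    hs.trans hLU, hg, fun x hx => hg1.self_of_nhdsSet x hx⟩

theorem lipschitzWith_extend {p q : ℂ} {γ : Path p q} {K : ℝ≥0} (h : LipschitzWith K γ) :
    LipschitzWith K γ.extend := by
  have := h.comp (LipschitzWith.projIcc (zero_le_one (α := ℝ)))
  rwa [mul_one] at this

/-- Green's formula for a disc domain, up to the value `k` of the index. -/
theorem exists_green {D : Set ℂ} (hD : IsDiscDomain D) {p : ℂ} {γ : Path p p}
    (hγ : ParametrizesBoundary γ D) :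
    ∃ k : ℂ, ∀ g : ℂ → ℂ, ContDiff ℝ 1 g → HasCompactSupport g →
      ∫ t in (0 : ℝ)..1, g (γ.extend t) * deriv γ.extend t = k * ∫ w in D, dbar g w := by
  obtain ⟨K, hK⟩ := hγ.lipschitz
  have hc := lipschitzWith_extend hK
  have hr : range γ.extend = frontier D := γ.extend_range.trans hγ.range_eq
  have hcl : ∀ t, γ.extend t ∈ frontier D := fun t => hr ▸ mem_range_self t
  have h01 : γ.extend 0 = γ.extend 1 := by simp
  have hcb : Bornology.IsBounded (range γ.extend) :=
    hr ▸ hD.isBounded.closure.subset frontier_subset_closure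
  have hdis : Disjoint D (frontier D) := by
    rw [hD.isOpen.frontier_eq]
    exact disjoint_sdiff_right
  obtain ⟨k, hk⟩ := exists_cauchyIndex_eq hc h01 isClosed_frontier hcl hD.isOpen
    hD.isConnected.isPreconnected hdis
  obtain ⟨e⟩ := hD.closure_homeo
  have h0 : ∀ w ∉ closure D, cauchyIndex γ.extend w = 0 := fun w hw =>
    cauchyIndex_eq_zero hc h01 isClosed_closure e (fun t => frontier_subset_closure (hcl t)) hw
  have hnull : ∀ᵐ w, w ∉ frontier D := by
    rw [← hr]
    exact measure_eq_zero_iff_ae_notMem.1 (volume_range_eq_zero hc)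
  refine ⟨k / π, fun g hg hgc => ?_⟩
  have hπ : (π : ℂ) ≠ 0 := ofReal_ne_zero.2 Real.pi_ne_zero
  have h2 : ∫ w, dbar g w * cauchyIndex γ.extend w = k * ∫ w in D, dbar g w := by
    rw [← integral_const_mul, ← integral_indicator hD.isOpen.measurableSet]
    refine integral_congr_ae ?_
    filter_upwards [hnull] with w hw
    by_cases hwD : w ∈ D
    · rw [indicator_of_mem hwD, hk w hwD, mul_comm]
    · have : w ∉ closure D := fun h => hw (by
        rw [hD.isOpen.frontier_eq]
        exact ⟨h, hwD⟩)
      rw [indicator_of_notMem hwD, h0 w this, mul_zero]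
  rw [← pi_mul_integral_comp_mul_deriv hc hcb hg hgc] at h2
  field_simp
  rw [← h2]
  ring

/-- The complex measure `dz` on a Lipschitz curve without self-intersections is not zero. -/
theorem exists_integral_comp_mul_deriv_ne_zero {c : ℝ → ℂ} {K : ℝ≥0} (hc : LipschitzWith K c)
    (hinj : InjOn c (Ico 0 1)) :
    ∃ g : ℂ → ℂ, ContDiff ℝ 1 g ∧ HasCompactSupport g ∧
      ∫ t in (0 : ℝ)..1, g (c t) * deriv c t ≠ 0 := by
  by_contra! hcon
  -- Bumps shrinking to the arc `c '' J` pick out `∫ c'` over `J`, the difference of two distinct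
  -- points of the curve. Any nondegenerate compact `J` inside `(0, 1)` would serve.
  set J : Set ℝ := Icc (1 / 4) (1 / 2) with hJ
  have hB : IsCompact (c '' J) := isCompact_Icc.image hc.continuous
  have hg : ∀ n : ℕ, ∃ g : ℂ → ℝ, ContDiff ℝ 1 g ∧ HasCompactSupport g ∧
      tsupport g ⊆ Metric.thickening (1 / (n + 1)) (c '' J) ∧
      (∀ x, g x ∈ Icc (0 : ℝ) 1) ∧ ∀ x ∈ c '' J, g x = 1 := fun n =>
    exists_contDiff_bump hB Metric.isOpen_thickening (Metric.self_subset_thickening (by positivity) _)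
  choose g hgd hgc hgs hgr hg1 using hg
  have hz : ∀ n, ∫ t in (0 : ℝ)..1, (g n (c t) : ℂ) * deriv c t = 0 := fun n =>
    hcon (fun z => (g n z : ℂ)) (ofRealCLM.contDiff.comp (hgd n)) ((hgc n).comp_left ofReal_zero)
  have hlim : Tendsto (fun n => ∫ t in (0 : ℝ)..1, (g n (c t) : ℂ) * deriv c t) atTop
      (𝓝 (∫ t in (0 : ℝ)..1, J.indicator (deriv c) t)) := by
    refine intervalIntegral.tendsto_integral_filter_of_dominated_convergence (fun _ => (K : ℝ))
      (Eventually.of_forall fun n => ?_) (Eventually.of_forall fun n => ?_)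
      intervalIntegrable_const ?_
    · have h1 := (hgd n).continuous.measurable
      have h2 := measurable_deriv c
      have h3 := hc.continuous.measurable
      exact Measurable.aestronglyMeasurable (by fun_prop)
    · refine ae_of_all _ fun t _ => ?_
      have h1 := hgr n (c t)
      rw [norm_mul, norm_real, Real.norm_of_nonneg h1.1]
      exact (mul_le_of_le_one_left (norm_nonneg _) h1.2).trans (norm_deriv_le_of_lipschitz hc)
    -- Injectivity is known on `[0, 1)` only, so the endpoint is discarded as a null set.
    · have h1 : ∀ᵐ t : ℝ, t ≠ 1 := by simp [ae_iff]
      filter_upwards [h1] with t ht1 ht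
      rw [uIoc_of_le zero_le_one] at ht
      by_cases htJ : t ∈ J
      · rw [indicator_of_mem htJ]
        simp only [hg1 _ _ (mem_image_of_mem c htJ), ofReal_one, one_mul]
        exact tendsto_const_nhds
      · rw [indicator_of_notMem htJ]
        have hct : c t ∉ c '' J := by
          rintro ⟨s, hs, hst⟩
          have := hinj ⟨by linarith [hs.1], by linarith [hs.2]⟩
            ⟨ht.1.le, lt_of_le_of_ne ht.2 ht1⟩ hst
          exact htJ (this ▸ hs)
        have hpos : 0 < Metric.infDist (c t) (c '' J) :=
          (hB.isClosed.notMem_iff_infDist_pos ⟨_, mem_image_of_mem c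
            (left_mem_Icc.2 (by norm_num))⟩).1 hct
        refine tendsto_const_nhds.congr' ?_
        filter_upwards [tendsto_one_div_add_atTop_nhds_zero_nat.eventually_lt_const hpos] with n hn
        have : g n (c t) = 0 := by
          refine image_eq_zero_of_notMem_tsupport fun h => ?_
          have := Metric.mem_thickening_iff_infDist_lt ⟨_, mem_image_of_mem c
            (left_mem_Icc.2 (by norm_num))⟩ |>.1 (hgs n h)
          linarith
        rw [this, ofReal_zero, zero_mul]
  simp only [hz] at hlim
  have h0 := tendsto_nhds_unique hlim tendsto_const_nhds
  have h1 : ∫ t in (0 : ℝ)..1, J.indicator (deriv c) t = c (1 / 2) - c (1 / 4) := by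
    rw [← integral_deriv_of_lipschitz hc (by norm_num) (by norm_num),
      intervalIntegral.integral_of_le zero_le_one, intervalIntegral.integral_of_le (by norm_num),
      integral_indicator measurableSet_Icc, Measure.restrict_restrict measurableSet_Icc,
      inter_eq_left.2, integral_Icc_eq_integral_Ioc]
    exact fun x hx => ⟨by linarith [hx.1], by linarith [hx.2]⟩
  rw [h1] at h0
  have := hinj (by norm_num) (by norm_num) (sub_eq_zero.1 h0)
  norm_num at this

/-! ### Rigid motions and the Pompeiu property. -/

theorem boundaryIntegral_eq (f : ℂ → ℂ) {p : ℂ} (γ : Path p p) (a : Circle) (b : ℂ) :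
    boundaryIntegral f γ a b =
      a * ∫ t in (0 : ℝ)..1, f (a * γ.extend t + b) * deriv γ.extend t := by
  have h1 : (γ.map (continuous_rigidMotion a b)).extend = fun t => a * γ.extend t + b := by
    ext t
    rfl
  rw [boundaryIntegral, curveIntegral_eq_intervalIntegral_deriv, h1,
    ← intervalIntegral.integral_const_mul]
  refine intervalIntegral.integral_congr fun t _ => ?_
  simp only [deriv_add_const, deriv_const_mul_field, _root_.smul_apply,
    ContinuousLinearMap.id_apply, smul_eq_mul]
  ring

/-- The chain rule for a holomorphic inner map: the factor is the conjugate of its derivative `a`.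
-/
theorem dbar_comp_rigidMotion {F : ℂ → ℂ} (hF : Differentiable ℝ F) (a : Circle) (b z : ℂ) :
    dbar (fun z => F (a * z + b)) z = (starRingEnd ℂ) a * dbar F (a * z + b) := by
  have h1 : HasFDerivAt (fun z : ℂ => (a : ℂ) * z + b)
      ((a : ℂ) • ContinuousLinearMap.id ℝ ℂ) z :=
    ((hasFDerivAt_id z).const_mul (a : ℂ)).add_const b
  have h2 := ((hF (a * z + b)).hasFDerivAt.comp z h1).fderiv
  have h3 : fderiv ℝ (fun z => F (a * z + b)) z =
    (fderiv ℝ F (a * z + b)).comp ((a : ℂ) • ContinuousLinearMap.id ℝ ℂ) := h2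
  have e1 : (a : ℂ) * 1 = (a : ℂ).re • (1 : ℂ) + (a : ℂ).im • I := by
    apply Complex.ext <;> simp
  have e2 : (a : ℂ) * I = (-(a : ℂ).im) • (1 : ℂ) + (a : ℂ).re • I := by
    apply Complex.ext <;> simp
  have e3 : (starRingEnd ℂ) (a : ℂ) = (a : ℂ).re - (a : ℂ).im * I := by
    apply Complex.ext <;> simp
  simp only [dbar, h3, ContinuousLinearMap.comp_apply, _root_.smul_apply,
    ContinuousLinearMap.id_apply, smul_eq_mul]
  rw [e1, e2, e3]
  simp only [map_add, map_smul]
  simp only [real_smul]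
  push_cast
  linear_combination ((a : ℂ).im * fderiv ℝ F (a * z + b) I / 2) * I_sq

theorem dbar_congr {F G : ℂ → ℂ} {z : ℂ} (h : F =ᶠ[𝓝 z] G) : dbar F z = dbar G z := by
  rw [dbar, dbar, h.fderiv_eq]

theorem setIntegral_image_rigidMotion (a : Circle) (b : ℂ) (D : Set ℂ) (h : ℂ → ℂ) :
    ∫ z in rigidMotion a b '' D, h z = ∫ z in D, h (a * z + b) := by
  let e : ℂ ≃ᵢ ℂ := (rotation a).toIsometryEquiv.trans (IsometryEquiv.addRight b)
  have he : ⇑e = rigidMotion a b := by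
    ext z
    simp [e, rigidMotion]
  have hm : MeasurePreserving e volume volume :=
    (measurePreserving_add_right volume b).comp (rotation a).measurePreserving
  rw [← he, hm.setIntegral_image_emb e.toHomeomorph.measurableEmbedding, he]
  rfl

theorem setIntegral_dbar_eq_zero {D : Set ℂ} (hD : IsDiscDomain D) {p : ℂ} {γ : Path p p}
    (hγ : ParametrizesBoundary γ D) {F : ℂ → ℂ} (hF : ContDiff ℝ 1 F) (a : Circle) (b : ℂ)
    (h : boundaryIntegral F γ a b = 0) : ∫ z in rigidMotion a b '' D, dbar F z = 0 := by
  obtain ⟨k, hk⟩ := exists_green hD hγ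
  obtain ⟨K, hK⟩ := hγ.lipschitz
  have hk0 : k ≠ 0 := by
    have hinj : InjOn γ.extend (Ico 0 1) := by
      intro s hs t ht hst
      have hs' : s ∈ unitInterval := Ico_subset_Icc_self hs
      have ht' : t ∈ unitInterval := Ico_subset_Icc_self ht
      rw [Path.extend_apply γ hs', Path.extend_apply γ ht'] at hst
      have := hγ.injOn (fun h => hs.2.ne (congrArg Subtype.val h))
        (fun h => ht.2.ne (congrArg Subtype.val h)) hst
      exact congrArg Subtype.val this
    obtain ⟨g, hg, hgc, hne⟩ := exists_integral_comp_mul_deriv_ne_zero (lipschitzWith_extend hK) hinj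
    rintro rfl
    rw [hk g hg hgc, zero_mul] at hne
    exact hne rfl
  -- Green's formula is available for compact support only; a cutoff equal to one on `closure D`
  -- changes neither side.
  obtain ⟨χ, hχ, hχc, -, -, hχ1⟩ := exists_contDiff_bump hD.isBounded.isCompact_closure isOpen_univ
    (subset_univ _)
  have hFσ : ContDiff ℝ 1 fun z => F (a * z + b) := by fun_prop
  have key := hk (fun z => χ z * F (a * z + b))
    ((ofRealCLM.contDiff.comp hχ).mul hFσ) (by
      exact HasCompactSupport.mul_right (hχc.comp_left (g := ofReal) ofReal_zero))
  have h1 : ∫ t in (0 : ℝ)..1, (χ (γ.extend t) * F (a * γ.extend t + b)) * deriv γ.extend t = 0 := by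
    rw [boundaryIntegral_eq, mul_eq_zero] at h
    rw [← h.resolve_left a.coe_ne_zero]
    refine intervalIntegral.integral_congr fun t _ => ?_
    have : γ.extend t ∈ closure D := frontier_subset_closure
      (hγ.range_eq ▸ γ.extend_range ▸ mem_range_self t)
    simp only [hχ1 _ this, ofReal_one, one_mul]
  have h2 : ∫ z in D, dbar (fun z => χ z * F (a * z + b)) z =
      (starRingEnd ℂ) a * ∫ z in rigidMotion a b '' D, dbar F z := by
    rw [setIntegral_image_rigidMotion, ← integral_const_mul]
    refine setIntegral_congr_fun hD.isOpen.measurableSet fun z hz => ?_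
    rw [← dbar_comp_rigidMotion (hF.differentiable one_ne_zero)]
    refine dbar_congr ?_
    filter_upwards [hD.isOpen.mem_nhds hz] with w hw
    rw [hχ1 w (subset_closure hw), ofReal_one, one_mul]
  rw [h1, h2] at key
  have h3 : (starRingEnd ℂ) (a : ℂ) ≠ 0 := by simp
  simpa [hk0, h3] using key.symm

/-! ### Mollification. -/

theorem integrable_prod_convolution {f : ℂ → ℂ} (hf : LocallyIntegrable f volume) {φ : ℂ → ℝ}
    (hφ : Continuous φ) (hφc : HasCompactSupport φ) {α : Type*} [MeasurableSpace α]
    {μ : Measure α} [SFinite μ] {v w : α → ℂ} (hv : Measurable v) (hw : Measurable w)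
    (h : Integrable (fun t => ((fun y => ‖φ y‖) ⋆[ContinuousLinearMap.lsmul ℝ ℝ, volume]
      fun y => ‖f y‖) (v t) * ‖w t‖) μ) :
    Integrable (fun q : α × ℂ => φ q.2 • f (v q.1 - q.2) * w q.1) (μ.prod volume) := by
  have hq : Measure.QuasiMeasurePreserving (fun q : α × ℂ => v q.1 - q.2)
      (μ.prod volume) volume :=
    QuasiMeasurePreserving.prod_of_right (by fun_prop)
      (ae_of_all _ fun t => quasiMeasurePreserving_sub_left volume (v t))
  rw [integrable_prod_iff]
  · refine ⟨ae_of_all _ fun t => ?_, ?_⟩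
    · have : Integrable (fun y => φ y • f (v t - y)) :=
        hφc.convolutionExists_left (ContinuousLinearMap.lsmul ℝ ℝ) hφ hf (v t)
      exact this.mul_const (w t)
    · refine h.congr (ae_of_all _ fun t => ?_)
      simp only [convolution, norm_mul, norm_smul, ContinuousLinearMap.lsmul_apply, smul_eq_mul]
      rw [integral_mul_const]
  · refine AEStronglyMeasurable.mul ?_ ?_
    · exact (hφ.measurable.comp measurable_snd).aestronglyMeasurable.smul
        (hf.aestronglyMeasurable.comp_quasiMeasurePreserving hq)
    · exact (hw.comp measurable_fst).aestronglyMeasurable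

theorem continuous_convolution_norm {f : ℂ → ℂ} (hf : LocallyIntegrable f volume) {φ : ℂ → ℝ}
    (hφ : Continuous φ) (hφc : HasCompactSupport φ) :
    Continuous ((fun y => ‖φ y‖) ⋆[ContinuousLinearMap.lsmul ℝ ℝ, volume] fun y => ‖f y‖) :=
  hφc.norm.continuous_convolution_left _ hφ.norm fun x =>
    let ⟨s, hs, h⟩ := hf x
    ⟨s, hs, h.norm⟩

/-- By Fubini this is the average, with weight `φ y`, of the boundary integrals of `f` at the
translations `b - y`. The exceptional `y` form a null set, so the conclusion holds for every `b`. -/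
theorem boundaryIntegral_convolution_eq_zero {f : ℂ → ℂ} (hf : LocallyIntegrable f volume)
    {φ : ℂ → ℝ} (hφ : Continuous φ) (hφc : HasCompactSupport φ) {p : ℂ} {γ : Path p p} {K : ℝ≥0}
    (hK : LipschitzWith K γ) {a : Circle} (h : ∀ᵐ b : ℂ, boundaryIntegral f γ a b = 0) (b : ℂ) :
    boundaryIntegral (φ ⋆[ContinuousLinearMap.lsmul ℝ ℝ, volume] f) γ a b = 0 := by
  have hc := lipschitzWith_extend hK
  rw [boundaryIntegral_eq, intervalIntegral.integral_of_le zero_le_one]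
  simp only [convolution, ContinuousLinearMap.lsmul_apply, ← integral_mul_const]
  have hv : Continuous fun t => (a : ℂ) * γ.extend t + b := by
    have := hc.continuous
    fun_prop
  have hint : Integrable (fun t => ((fun y => ‖φ y‖) ⋆[ContinuousLinearMap.lsmul ℝ ℝ, volume]
      fun y => ‖f y‖) (a * γ.extend t + b) * ‖deriv γ.extend t‖) (volume.restrict (Ioc 0 1)) := by
    have h3 : IntervalIntegrable (fun t => ‖deriv γ.extend t‖) volume 0 1 := by
      have := (intervalIntegrable_comp_mul_deriv (G := fun _ => 1) hc (a := 0) (b := 1)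
        continuousOn_const).norm
      simpa using this
    have := h3.continuousOn_mul ((continuous_convolution_norm hf hφ hφc).comp hv).continuousOn
    rwa [intervalIntegrable_iff_integrableOn_Ioc_of_le zero_le_one] at this
  rw [integral_integral_swap (integrable_prod_convolution hf hφ hφc hv.measurable
      (measurable_deriv _) hint),
    integral_eq_zero_of_ae, mul_zero]
  filter_upwards [(quasiMeasurePreserving_sub_left volume b).ae h] with y hy
  rw [boundaryIntegral_eq, mul_eq_zero] at hy
  have h1 := hy.resolve_left a.coe_ne_zero
  rw [intervalIntegral.integral_of_le zero_le_one] at h1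
  simp only [smul_mul_assoc, Pi.zero_apply]
  rw [integral_smul]
  simp only [add_sub_assoc, h1, smul_zero]

theorem differentiable_convolution {D : Set ℂ} (hD : IsDiscDomain D) (hP : HasPompeiuProperty D)
    {p : ℂ} {γ : Path p p} (hγ : ParametrizesBoundary γ D) {f : ℂ → ℂ}
    (hf : LocallyIntegrable f volume) (h : ∀ a : Circle, ∀ᵐ b : ℂ, boundaryIntegral f γ a b = 0)
    {φ : ℂ → ℝ} (hφ : ContDiff ℝ 1 φ) (hφc : HasCompactSupport φ) :
    Differentiable ℂ (φ ⋆[ContinuousLinearMap.lsmul ℝ ℝ, volume] f) := by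
  have hF : ContDiff ℝ 1 (φ ⋆[ContinuousLinearMap.lsmul ℝ ℝ, volume] f) :=
    hφc.contDiff_convolution_left _ hφ hf
  obtain ⟨K, hK⟩ := hγ.lipschitz
  have h0 := hP (dbar (φ ⋆[ContinuousLinearMap.lsmul ℝ ℝ, volume] f))
    (continuous_dbar hF).locallyIntegrable fun a b => setIntegral_dbar_eq_zero hD hγ hF a b
      (boundaryIntegral_convolution_eq_zero hf hφ.continuous hφc hK (h a) b)
  have h1 := ((continuous_dbar hF).ae_eq_iff_eq volume continuous_const).1 h0
  exact differentiable_of_dbar_eq_zero (hF.differentiable one_ne_zero) fun z => congrFun h1 z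

/-! ### The mean value property and Weyl's lemma. -/

theorem integral_circle_eq {F : ℂ → ℂ} (hF : Differentiable ℂ F) (x : ℂ) (r : ℝ) :
    ∫ θ in Ioo (-π) π, F (x - r * exp (θ * I)) = 2 * π * F x := by
  -- The radius is `-r` because convolution evaluates `F` at `x - y`.
  have h1 : Real.circleAverage F x (-r) = F x := (hF.diffContOnCl).circleAverage
  have h2 := ((periodic_circleMap x (-r)).comp F).intervalIntegral_add_eq (-π) 0
  have h3 : ∀ θ : ℝ, F (x - r * exp (θ * I)) = F (circleMap x (-r) θ) := fun θ => by
    rw [circleMap, ofReal_neg, neg_mul, sub_eq_add_neg]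
  rw [zero_add, show -π + 2 * π = π by ring] at h2
  rw [Real.circleAverage, inv_smul_eq_iff₀ (by positivity)] at h1
  rw [← integral_Ioc_eq_integral_Ioo, ← intervalIntegral.integral_of_le (by linarith [Real.pi_pos])]
  simp only [h3]
  refine h2.trans (h1.trans ?_)
  rw [real_smul]
  push_cast
  rfl

theorem integral_radial_mul_eq {F : ℂ → ℂ} (hF : Differentiable ℂ F) {η : ℝ → ℝ}
    (hη : Continuous η) {R : ℝ} (hR : ∀ r, R ≤ r → η r = 0) (x : ℂ) :
    ∫ y, (η ‖y‖ : ℂ) * F (x - y) = (∫ r in Ioi (0 : ℝ), (r * η r : ℂ)) * (2 * π * F x) := by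
  rw [← Complex.integral_comp_polarCoord_symm, ← integral_mul_const]
  have h1 : ∀ p ∈ polarCoord.target, p.1 • ((η ‖Complex.polarCoord.symm p‖ : ℂ) *
      F (x - Complex.polarCoord.symm p)) = p.1 * η p.1 * F (x - p.1 * exp (p.2 * I)) := by
    rintro ⟨r, θ⟩ ⟨hr, hθ⟩
    rw [Complex.norm_polarCoord_symm, abs_of_pos hr, polarCoord_symm_eq, real_smul, mul_assoc]
  rw [setIntegral_congr_fun polarCoord.open_target.measurableSet h1]
  have hFc := hF.continuous
  have hint : IntegrableOn (fun p : ℝ × ℝ => (p.1 * η p.1 : ℂ) * F (x - p.1 * exp (p.2 * I)))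
      (Ioi (0 : ℝ) ×ˢ Ioo (-π) π) := by
    refine IntegrableOn.of_forall_sdiff_eq_zero (s := Ioc 0 R ×ˢ Ioo (-π) π) ?_
      (measurableSet_Ioi.prod measurableSet_Ioo) ?_
    · exact (Continuous.continuousOn (by fun_prop)).integrableOn_compact
        (isCompact_Icc.prod isCompact_Icc) |>.mono_set
          (prod_mono Ioc_subset_Icc_self Ioo_subset_Icc_self)
    · rintro ⟨r, θ⟩ ⟨⟨hr, hθ⟩, hn⟩
      have hrR : R ≤ r := by
        by_contra! h
        exact hn ⟨⟨hr, h.le⟩, hθ⟩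
      simp [hR r hrR]
  refine (setIntegral_prod _ hint).trans ?_
  refine integral_congr_ae (ae_of_all _ fun r => ?_)
  simp only
  rw [integral_const_mul, integral_circle_eq hF]

theorem convolution_radial_eq {F : ℂ → ℂ} (hF : Differentiable ℂ F) {η : ℝ → ℝ}
    (hη : Continuous η) {R : ℝ} (hR : ∀ r, R ≤ r → η r = 0) (x : ℂ) :
    ∫ y, (η ‖y‖ : ℂ) * F (x - y) = (∫ y : ℂ, η ‖y‖ : ℝ) * F x := by
  -- The constant function `1` identifies the radial integral with the mass of the kernel.
  have h1 := integral_radial_mul_eq (F := fun _ => 1) (differentiable_const _) hη hR x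
  simp only [mul_one] at h1
  have h2 : ((∫ y : ℂ, η ‖y‖ : ℝ) : ℂ) = ∫ y : ℂ, (η ‖y‖ : ℂ) := integral_ofReal.symm
  rw [integral_radial_mul_eq hF hη hR, h2, h1]
  ring

theorem exists_radial_bump : ∃ η : ℝ → ℝ, Continuous η ∧ (∀ r, 1 ≤ r → η r = 0) ∧
    ContDiff ℝ 1 (fun y : ℂ => η ‖y‖) ∧ HasCompactSupport (fun y : ℂ => η ‖y‖) ∧
    0 < ∫ y : ℂ, η ‖y‖ := by
  have h1 : ∀ r : ℝ, 1 ≤ r → Real.smoothTransition (1 - r ^ 2) = 0 := fun r hr =>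
    Real.smoothTransition.zero_of_nonpos (by nlinarith)
  have h2 : ContDiff ℝ 1 (fun y : ℂ => Real.smoothTransition (1 - ‖y‖ ^ 2)) :=
    Real.smoothTransition.contDiff.comp (contDiff_const.sub (contDiff_norm_sq ℝ))
  have h3 : HasCompactSupport (fun y : ℂ => Real.smoothTransition (1 - ‖y‖ ^ 2)) :=
    HasCompactSupport.intro (isCompact_closedBall 0 1) fun y hy =>
      h1 _ (by simpa using (not_le.1 (mem_closedBall_zero_iff.not.1 hy)).le)
  -- The square keeps the bump smooth at the origin, where the norm is not.
  refine ⟨fun r => Real.smoothTransition (1 - r ^ 2), by fun_prop, h1, h2, h3, ?_⟩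
  refine h2.continuous.integral_pos_of_hasCompactSupport_nonneg_nonzero (x := 0) h3
    (fun y => Real.smoothTransition.nonneg _) ?_
  simp

theorem integral_convolution_comm {f : ℂ → ℂ} (hf : LocallyIntegrable f volume) {φ ρ : ℂ → ℝ}
    (hφ : Continuous φ) (hφc : HasCompactSupport φ) (hρ : Continuous ρ)
    (hρc : HasCompactSupport ρ) (x : ℂ) :
    ∫ y, (ρ y : ℂ) * (φ ⋆[ContinuousLinearMap.lsmul ℝ ℝ, volume] f) (x - y) =
      ∫ s, (φ s : ℂ) * (ρ ⋆[ContinuousLinearMap.lsmul ℝ ℝ, volume] f) (x - s) := by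
  have hint : Integrable (fun y => ((fun y => ‖φ y‖) ⋆[ContinuousLinearMap.lsmul ℝ ℝ, volume]
      fun y => ‖f y‖) (x - y) * ‖(ρ y : ℂ)‖) volume := by
    refine Continuous.integrable_of_hasCompactSupport ?_ ?_
    · exact ((continuous_convolution_norm hf hφ hφc).comp (by fun_prop)).mul (by fun_prop)
    · exact HasCompactSupport.mul_left (hρc.comp_left (g := fun r : ℝ => ‖(r : ℂ)‖) (by simp))
  have key := integral_integral_swap
    (f := fun y s => φ s • f (x - y - s) * (ρ y : ℂ)) (integrable_prod_convolution hf hφ hφc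
    (v := fun y => x - y) (w := fun y => ρ y) (by fun_prop) (by fun_prop) hint)
  simp only [integral_mul_const] at key
  simp only [convolution, ContinuousLinearMap.lsmul_apply]
  calc ∫ y, (ρ y : ℂ) * ∫ t, φ t • f (x - y - t)
      = ∫ y, (∫ t, φ t • f (x - y - t)) * (ρ y : ℂ) := by simp only [mul_comm]
    _ = _ := key
    _ = _ := by
      refine integral_congr_ae (ae_of_all _ fun s => ?_)
      simp only
      rw [← integral_const_mul]
      refine integral_congr_ae (ae_of_all _ fun y => ?_)
      simp only [real_smul]
      rw [sub_right_comm x y s]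
      ring

/-- Weyl's lemma, in terms of convolutions. -/
theorem exists_entire_of_convolution {f : ℂ → ℂ} (hf : LocallyIntegrable f volume)
    (h : ∀ φ : ℂ → ℝ, ContDiff ℝ 1 φ → HasCompactSupport φ →
      Differentiable ℂ (φ ⋆[ContinuousLinearMap.lsmul ℝ ℝ, volume] f)) :
    ∃ g : ℂ → ℂ, Differentiable ℂ g ∧ f =ᵐ[volume] g := by
  obtain ⟨η, hη, hη1, hρ, hρc, hpos⟩ := exists_radial_bump
  set m : ℝ := ∫ y : ℂ, η ‖y‖
  set r : ℂ → ℂ := (fun y : ℂ => η ‖y‖) ⋆[ContinuousLinearMap.lsmul ℝ ℝ, volume] f with hr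
  have hrd : Differentiable ℂ r := h _ hρ hρc
  have hm : (m : ℂ) ≠ 0 := ofReal_ne_zero.2 hpos.ne'
  refine ⟨fun z => (m : ℂ)⁻¹ * r z, hrd.const_mul _, ?_⟩
  refine ae_eq_of_integral_contDiff_smul_eq hf
    (hrd.continuous.const_mul _).locallyIntegrable fun g hg hgc => ?_
  -- With this reflection, convolution with `φ` evaluated at `0` is the pairing with the test
  -- function `g`.
  set φ : ℂ → ℝ := fun s => g (-s) with hφ
  have hφd : ContDiff ℝ 1 φ := (hg.of_le (by exact_mod_cast le_top)).comp contDiff_neg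
  have hφc : HasCompactSupport φ := hgc.comp_homeomorph (Homeomorph.neg ℂ)
  have h1 := integral_convolution_comm hf hφd.continuous hφc hρ.continuous hρc 0
  -- As `φ * f` is entire, `ρ * (φ * f) = m (φ * f)`; comparing with `φ * (ρ * f)` at `0` gives `m ∫
  -- g f = ∫ g r`.
  rw [convolution_radial_eq (h φ hφd hφc) hη hη1, ← hr] at h1
  have h2 : ∀ u : ℂ → ℂ, ∫ s, (φ s : ℂ) * u (0 - s) = ∫ s, g s • u s := fun u => by
    rw [← integral_neg_eq_self (fun s => g s • u s)]
    simp [hφ]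
  have h3 : (φ ⋆[ContinuousLinearMap.lsmul ℝ ℝ, volume] f) 0 = ∫ s, g s • f s := by
    rw [← h2]
    simp [convolution]
  rw [h2, h3] at h1
  have h4 : ∀ s, g s • ((m : ℂ)⁻¹ * r s) = (m : ℂ)⁻¹ * (g s • r s) := fun s =>
    (mul_smul_comm _ _ _).symm
  simp only [h4]
  rw [integral_const_mul, ← h1, inv_mul_cancel_left₀ hm]
/-- As `f` is a class of functions modulo null sets, the boundary integrals are required to vanish
only for every rotation and almost every translation. For these they exist as Lebesgue integrals,
and the requirement does not depend on the representative of `f`. -/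
theorem theorem4 (D : Set ℂ) (hD : IsDiscDomain D) (hP : HasPompeiuProperty D)
    (p : ℂ) (γ : Path p p) (hγ : ParametrizesBoundary γ D)
    (f : ℂ → ℂ) (hf : LocallyIntegrable f volume)
    (h : ∀ a : Circle, ∀ᵐ b : ℂ, boundaryIntegral f γ a b = 0) :
    ∃ g : ℂ → ℂ, Differentiable ℂ g ∧ f =ᵐ[volume] g := by
  exact exists_entire_of_convolution hf fun φ hφ hφc =>
    differentiable_convolution hD hP hγ hf h hφ hφc
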